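/- Let $n$ parties with finite-dimensional Hilbert spaces share a (possibly mixed) state $\rho$, and let $A\neq B$ be two distinguished parties, of dimensions $d_A$ and $d_B$. For a unit vector $|\psi\rangle=\sum_{ij}a_{ij}|i\rangle|j\rangle\in\mathbb{C}^d\otimes\mathbb{C}^d$ with coefficient matrix $M=(a_{ij})$ and Schmidt numbers $\lambda_0,\dots,\lambda_{d-1}$ (the eigenvalues of $M^\dagger M$), the G-concurrence is $G(|\psi\rangle)=d(\lambda_0\cdots\lambda_{d-1})^{1/d}=d[\det(M^\dagger M)]^{1/d}$; on pure states of two systems of different dimensions $G$ is set to $0$. On mixed bipartite states $G$ is the convex roof $G(\sigma)=\inf\sum_i p_iG(|\psi_i\rangle)$ over all finite ensembles of pure states with $\sigma=\sum_ip_i|\psi_i\rangle\langle\psi_i|$. An LOCC protocol has finitely many rounds. In each round one party performs a local quantum instrument with finitely many outcomes (a finite family of completely positive maps with trace-preserving sum, the output dimension of which may differ from the input dimension) and announces the outcome to all parties; the later rounds may depend on all earlier outcomes. At the end $A$ and $B$ must again hold systems of dimensions $d_A$ and $d_B$. The average G-concurrence of the protocol is $\sum_k p_kG(\sigma_k^{AB})$,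 where $p_k$ is the probability of the outcome history $k$ and $\sigma_k^{AB}$ is the resulting reduced state of $A$ and $B$. The localizable entanglement $E_{\mathrm{Loc}}(\rho)$ is the supremum of these averages over all protocols in which only the $n-2$ parties other than $A$ and $B$ operate; the entanglement of collaboration $E_{\mathrm{Col}}(\rho)$ is the supremum over all protocols in which all $n$ parties, $A$ and $B$ included, may operate. Then both suprema are finite and, for every such $\rho$, $$E_{\mathrm{Loc}}(\rho)=E_{\mathrm{Col}}(\rho).$$ -/

import Mathlib

namespace QuantumLOCC

open scoped Matrix ComplexOrder

/-- Indices of the product basis of a system of `n` parties with local dimensions `dims`. -/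
abbrev Config {n : ℕ} (dims : Fin n → ℕ) : Type := ∀ i, Fin (dims i)

/-- Operators on the Hilbert space of all `n` parties, as matrices in the product basis. -/
abbrev Operator {n : ℕ} (dims : Fin n → ℕ) : Type := Matrix (Config dims) (Config dims) ℂ

/-- A (mixed) state: a positive semidefinite operator of trace one. -/
def IsState {ι : Type*} [Fintype ι] (ρ : Matrix ι ι ℂ) : Prop :=
  ρ.PosSemidef ∧ ρ.trace = 1

/-- The coefficient matrix of a vector of `ℂ ^ d ⊗ ℂ ^ e`. -/
def coeffMatrix {d e : ℕ} (ψ : Fin d × Fin e → ℂ) : Matrix (Fin d) (Fin e) ℂ :=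
  Matrix.of fun i j => ψ (i, j)

/-- The G-concurrence of a pure state: `d (λ₀ ⋯ λ_{d-1})^{1/d} = d (det (A† A))^{1/d}` for a
`d × d` system, where `A` is the coefficient matrix and the Schmidt numbers `λᵢ` are the
eigenvalues of `A† A`. It vanishes when the two local dimensions differ. -/
noncomputable def pureGConcurrence {d e : ℕ} (ψ : Fin d × Fin e → ℂ) : ℝ :=
  if d = e then
    (e : ℝ) * (((coeffMatrix ψ)ᴴ * coeffMatrix ψ).det.re) ^ (1 / (e : ℝ))
  else 0

/-- `{p i, ψ i}` is an ensemble of normalized pure states that realizes `ρ`. -/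
def IsPureEnsemble {ι : Type*} [Fintype ι] (ρ : Matrix ι ι ℂ) {r : ℕ}
    (p : Fin r → ℝ) (ψ : Fin r → ι → ℂ) : Prop :=
  (∀ i, 0 ≤ p i) ∧ ∑ i, p i = 1 ∧ (∀ i, ∑ x, ‖ψ i x‖ ^ 2 = 1) ∧
    ρ = ∑ i, (p i : ℂ) • Matrix.vecMulVec (ψ i) (star (ψ i))

/-- The G-concurrence of a mixed bipartite state: the convex roof of the pure state quantity. -/
noncomputable def gConcurrence {d e : ℕ} (ρ : Matrix (Fin d × Fin e) (Fin d × Fin e) ℂ) : ℝ :=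
  sInf {g | ∃ (r : ℕ) (p : Fin r → ℝ) (ψ : Fin r → Fin d × Fin e → ℂ),
    IsPureEnsemble ρ p ψ ∧ g = ∑ i, p i * pureGConcurrence (ψ i)}

/-- A local quantum operation with finitely many outcomes on a `d`-dimensional system. Outcome `j`
is the completely positive map with Kraus operators `kraus j k`; its output system may have
another dimension (ancillas may be added, subsystems discarded). The sum of all these maps is
trace preserving. -/
structure Instrument (d : ℕ) where
  outcomes : ℕ
  outDim : Fin outcomes → ℕ
  krausCount : Fin outcomes → ℕ
  kraus : ∀ j : Fin outcomes, Fin (krausCount j) → Matrix (Fin (outDim j)) (Fin d) ℂ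
  complete : ∑ j, ∑ k, (kraus j k)ᴴ * kraus j k = 1

/-- The operator `K` acting on party `i`, tensored with the identity on all the other parties. -/
def localOp {n : ℕ} (dims : Fin n → ℕ) (i : Fin n) (m : ℕ) (K : Matrix (Fin m) (Fin (dims i)) ℂ) :
    Matrix (Config (Function.update dims i m)) (Config dims) ℂ :=
  Matrix.of fun x y =>
    if ∀ j, j ≠ i → (x j : ℕ) = (y j : ℕ) then
      K (Fin.cast (Function.update_self i m dims) (x i)) (y i)
    else 0

/-- The unnormalized state of all the parties when the instrument `I`, performed by party `i`,
gives the outcome `j`. -/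
def Instrument.apply {n : ℕ} {dims : Fin n → ℕ} {i : Fin n} (I : Instrument (dims i))
    (j : Fin I.outcomes) (ρ : Operator dims) : Operator (Function.update dims i (I.outDim j)) :=
  ∑ k, localOp dims i (I.outDim j) (I.kraus j k) * ρ *
    (localOp dims i (I.outDim j) (I.kraus j k))ᴴ

/-- LOCC protocols, starting at local dimensions `dims`, in which only the parties of the set `S`
perform operations, and which end with systems of dimensions `a` and `b` at the parties `A` and
`B`. In each round one party performs a local operation and announces the outcome to all the
parties; the rest of the protocol may depend on that outcome. -/
inductive Protocol {n : ℕ} (S : Set (Fin n)) (A B : Fin n) (a b : ℕ) : (Fin n → ℕ) → Type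
  | done {dims : Fin n → ℕ} (hA : dims A = a) (hB : dims B = b) : Protocol S A B a b dims
  | step {dims : Fin n → ℕ} (i : Fin n) (hi : i ∈ S) (I : Instrument (dims i))
      (next : ∀ j : Fin I.outcomes,
        Protocol S A B a b (Function.update dims i (I.outDim j))) :
      Protocol S A B a b dims

open Classical in
/-- The reduced state of the parties `A` and `B`: the partial trace over all the others. -/
noncomputable def reducedState {n : ℕ} {dims : Fin n → ℕ} (A B : Fin n) (ρ : Operator dims) :
    Matrix (Fin (dims A) × Fin (dims B)) (Fin (dims A) × Fin (dims B)) ℂ :=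
  Matrix.of fun u v => ∑ x : Config dims, ∑ y : Config dims,
    if (x A, x B) = u ∧ (y A, y B) = v ∧ ∀ j, j ≠ A → j ≠ B → x j = y j then ρ x y else 0

/-- The average G-concurrence shared by `A` and `B` at the end of a protocol: each outcome `j`
occurs with probability `p`, the trace of the unnormalized state, and leaves the normalized
state. (An outcome of probability zero contributes zero.) -/
noncomputable def Protocol.average {n : ℕ} {S : Set (Fin n)} {A B : Fin n} {a b : ℕ} :
    {dims : Fin n → ℕ} → Protocol S A B a b dims → Operator dims → ℝ
  | _, .done _ _, ρ => gConcurrence (reducedState A B ρ)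
  | _, .step _ _ I next, ρ => ∑ j,
      let p : ℝ := (I.apply j ρ).trace.re
      p * (next j).average (((p⁻¹ : ℝ) : ℂ) • I.apply j ρ)

/-- The average G-concurrences that `A` and `B` can share after LOCC by the parties of `S`. -/
def achievable {n : ℕ} {dims : Fin n → ℕ} (S : Set (Fin n)) (A B : Fin n) (ρ : Operator dims) :
    Set ℝ :=
  {g | ∃ P : Protocol S A B (dims A) (dims B) dims, g = P.average ρ}

/-- Achievable averages when only the parties other than `A` and `B` operate. -/
def localizableValues {n : ℕ} {dims : Fin n → ℕ} (A B : Fin n) (ρ : Operator dims) : Set ℝ :=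
  achievable {i | i ≠ A ∧ i ≠ B} A B ρ

/-- Achievable averages when all the parties, `A` and `B` included, operate. -/
def collaborationValues {n : ℕ} {dims : Fin n → ℕ} (A B : Fin n) (ρ : Operator dims) : Set ℝ :=
  achievable Set.univ A B ρ

/-- The localizable entanglement with the G-concurrence as root entanglement measure. -/
noncomputable def localizableEntanglement {n : ℕ} {dims : Fin n → ℕ} (A B : Fin n)
    (ρ : Operator dims) : ℝ :=
  sSup (localizableValues A B ρ)

/-- The entanglement of collaboration with the G-concurrence as root entanglement measure. -/
noncomputable def entanglementOfCollaboration {n : ℕ} {dims : Fin n → ℕ} (A B : Fin n)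
    (ρ : Operator dims) : ℝ :=
  sSup (collaborationValues A B ρ)

end QuantumLOCC

/-! A local operator K of A multiplies the coefficient matrix of a d × d pure state, so it scales G
by |det K|^(2/d), the same factor for every state. By AM-GM for the eigenvalues of K†K this factor
is at most tr(K†K)/d, the weight of K (`pureGConcurrence_le_weight_mul`). When an instrument follows
K, completeness makes the weights of the products of its Kraus operators with K add up to the weight
of K (`sum_weight_kraus`). So operations of A or B cannot raise the average.

To remove one of these parties, p, from a protocol, everything p has done along a branch is
accumulated in a single, possibly rectangular, operator K. It commutes with the operations of the
others and is postponed to the end, where p has its original dimension again and K costs at most its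
weight. Where p measures, the average is at most a weighted sum of what the others reach in the
continuations, one for each Kraus operator; using the best continuation throughout loses nothing.
This is the induction `Protocol.exists_rawAverage_le`, started at K = 1, of weight 1, and applied to
A and then to B.

The bookkeeping is done on unnormalized states: `gRoof` and `Protocol.rawAverage` are homogeneous
and subadditive on positive operators, and bounded by the trace, whence finiteness. Operators of a
party are indexed by all of ℕ, so that changing dimensions need no casts. -/

namespace QuantumLOCC

open scoped Matrix ComplexOrder

/-! ### The G-concurrence of vectors -/

/-- The inequality of arithmetic and geometric means for the eigenvalues of a positive
semidefinite matrix. -/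
theorem card_mul_det_rpow_le_trace {d : ℕ} {M : Matrix (Fin d) (Fin d) ℂ} (hM : M.PosSemidef) :
    (d : ℝ) * M.det.re ^ (1 / (d : ℝ)) ≤ M.trace.re := by
  rcases Nat.eq_zero_or_pos d with rfl | hd
  · simp [Matrix.trace]
  have hd' : (0 : ℝ) < d := by exact_mod_cast hd
  have hdet : M.det.re = ∏ i, hM.isHermitian.eigenvalues i := by
    rw [hM.isHermitian.det_eq_prod_eigenvalues]
    norm_cast
  have htr : M.trace.re = ∑ i, hM.isHermitian.eigenvalues i := by
    rw [hM.isHermitian.trace_eq_sum_eigenvalues]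
    norm_cast
  have h := Real.geom_mean_le_arith_mean Finset.univ (fun _ : Fin d => (1 : ℝ))
    hM.isHermitian.eigenvalues (fun _ _ => zero_le_one) (by simpa using hd)
    (fun i _ => hM.eigenvalues_nonneg i)
  simp only [Real.rpow_one, one_mul, Finset.sum_const, Finset.card_univ, Fintype.card_fin,
    nsmul_eq_mul, mul_one, ← hdet, ← htr] at h
  rw [le_div_iff₀ hd'] at h
  rw [one_div]
  linarith

theorem det_conjTranspose_mul_self_re_nonneg {d e : ℕ} (M : Matrix (Fin d) (Fin e) ℂ) :
    0 ≤ (Mᴴ * M).det.re :=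
  (Complex.le_def.1 (Matrix.posSemidef_conjTranspose_mul_self M).det_nonneg).1

theorem pureGConcurrence_nonneg {d e : ℕ} (ψ : Fin d × Fin e → ℂ) : 0 ≤ pureGConcurrence ψ := by
  unfold pureGConcurrence
  split_ifs
  · exact mul_nonneg (Nat.cast_nonneg _)
      (Real.rpow_nonneg (det_conjTranspose_mul_self_re_nonneg _) _)
  · exact le_rfl

theorem det_conjTranspose_mul_self_re {d : ℕ} (M : Matrix (Fin d) (Fin d) ℂ) :
    (Mᴴ * M).det.re = ‖M.det‖ ^ 2 := by
  rw [Matrix.det_mul, Matrix.det_conjTranspose, ← Complex.ofReal_re (‖M.det‖ ^ 2)]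
  congr 1
  have := Complex.conj_mul' M.det
  push_cast
  exact this

/-- On a `d × d` system the G-concurrence of a vector is a power of the determinant of its
coefficient matrix. -/
theorem pureGConcurrence_self {d : ℕ} (ψ : Fin d × Fin d → ℂ) :
    pureGConcurrence ψ = (d : ℝ) * (‖(coeffMatrix ψ).det‖ ^ 2) ^ (1 / (d : ℝ)) := by
  rw [pureGConcurrence, if_pos rfl, det_conjTranspose_mul_self_re]

/-- Covers scalars, through the `d`-th power of the scalar, and local operators, through their
determinant. -/
theorem pureGConcurrence_of_det_eq {d : ℕ} {φ ψ : Fin d × Fin d → ℂ} {c : ℂ}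
    (h : (coeffMatrix φ).det = c * (coeffMatrix ψ).det) :
    pureGConcurrence φ = (‖c‖ ^ 2) ^ (1 / (d : ℝ)) * pureGConcurrence ψ := by
  rw [pureGConcurrence_self, pureGConcurrence_self, h, norm_mul, mul_pow,
    Real.mul_rpow (by positivity) (by positivity)]
  ring

theorem pureGConcurrence_smul {d e : ℕ} (c : ℂ) (ψ : Fin d × Fin e → ℂ) :
    pureGConcurrence (c • ψ) = ‖c‖ ^ 2 * pureGConcurrence ψ := by
  by_cases h : d = e
  · subst h
    rcases Nat.eq_zero_or_pos d with rfl | hd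
    · simp [pureGConcurrence]
    rw [pureGConcurrence_of_det_eq (ψ := ψ) (c := c ^ d)]
    · rw [norm_pow, ← pow_mul, mul_comm d 2, pow_mul, one_div,
        Real.pow_rpow_inv_natCast (by positivity) hd.ne']
    · have : coeffMatrix (c • ψ) = c • coeffMatrix ψ := by ext; simp [coeffMatrix]
      rw [this, Matrix.det_smul, Fintype.card_fin]
  · simp [pureGConcurrence, h]

theorem trace_conjTranspose_mul_self_re {m n : Type*} [Fintype m] [Fintype n] (M : Matrix m n ℂ) :
    (Mᴴ * M).trace.re = ∑ j, ∑ i, ‖M i j‖ ^ 2 := by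
  simp only [Matrix.trace, Matrix.diag, Matrix.mul_apply, Matrix.conjTranspose_apply,
    Complex.re_sum]
  refine Finset.sum_congr rfl fun j _ => Finset.sum_congr rfl fun i _ => ?_
  rw [← Complex.ofReal_re (‖M i j‖ ^ 2)]
  congr 1
  have := Complex.conj_mul' (M i j)
  push_cast
  exact this

/-- AM-GM for the Schmidt numbers, whose sum is the squared norm. -/
theorem pureGConcurrence_le {d e : ℕ} (ψ : Fin d × Fin e → ℂ) :
    pureGConcurrence ψ ≤ ∑ x, ‖ψ x‖ ^ 2 := by
  unfold pureGConcurrence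
  split_ifs with h
  · refine (card_mul_det_rpow_le_trace
      (Matrix.posSemidef_conjTranspose_mul_self (coeffMatrix ψ))).trans_eq ?_
    rw [trace_conjTranspose_mul_self_re, Finset.sum_comm, Fintype.sum_prod_type]
    rfl
  · positivity

/-! ### The convex roof on unnormalized states -/

open scoped MatrixOrder Matrix.Norms.L2Operator in
theorem exists_eq_conjTranspose_mul_self {ι : Type*} [Fintype ι] [DecidableEq ι]
    {σ : Matrix ι ι ℂ} (hσ : σ.PosSemidef) : ∃ C : Matrix ι ι ℂ, σ = Cᴴ * C :=
  CStarAlgebra.nonneg_iff_eq_star_mul_self.mp hσ.nonneg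

/-- The values of the decompositions of a positive operator into unnormalized pure states. -/
def roofValues {d e : ℕ} (σ : Matrix (Fin d × Fin e) (Fin d × Fin e) ℂ) : Set ℝ :=
  {g | ∃ (r : ℕ) (φ : Fin r → Fin d × Fin e → ℂ),
    σ = ∑ i, Matrix.vecMulVec (φ i) (star (φ i)) ∧ g = ∑ i, pureGConcurrence (φ i)}

/-- The convex roof of the G-concurrence, extended to unnormalized states. -/
noncomputable def gRoof {d e : ℕ} (σ : Matrix (Fin d × Fin e) (Fin d × Fin e) ℂ) : ℝ :=
  sInf (roofValues σ)

section Roof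

variable {d e : ℕ} {σ τ : Matrix (Fin d × Fin e) (Fin d × Fin e) ℂ}

theorem nonneg_of_mem_roofValues {g : ℝ} (hg : g ∈ roofValues σ) : 0 ≤ g := by
  obtain ⟨r, φ, -, rfl⟩ := hg
  exact Finset.sum_nonneg fun i _ => pureGConcurrence_nonneg _

theorem gRoof_nonneg : 0 ≤ gRoof σ :=
  Real.sInf_nonneg fun _ hg => nonneg_of_mem_roofValues hg

theorem gRoof_le {g : ℝ} (hg : g ∈ roofValues σ) : gRoof σ ≤ g :=
  csInf_le ⟨0, fun _ h => nonneg_of_mem_roofValues h⟩ hg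

theorem sum_mem_roofValues {ι : Type*} [Fintype ι] (φ : ι → Fin d × Fin e → ℂ)
    (h : σ = ∑ i, Matrix.vecMulVec (φ i) (star (φ i))) :
    ∑ i, pureGConcurrence (φ i) ∈ roofValues σ :=
  ⟨Fintype.card ι, φ ∘ (Fintype.equivFin ι).symm,
    by rw [h]; exact ((Fintype.equivFin ι).symm.sum_comp
      (fun i => Matrix.vecMulVec (φ i) (star (φ i)))).symm,
    ((Fintype.equivFin ι).symm.sum_comp (fun i => pureGConcurrence (φ i))).symm⟩

theorem roofValues_nonempty (hσ : σ.PosSemidef) : (roofValues σ).Nonempty := by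
  obtain ⟨B, rfl⟩ := exists_eq_conjTranspose_mul_self hσ
  refine ⟨_, sum_mem_roofValues (fun i => star (B i)) ?_⟩
  ext x y
  simp [Matrix.mul_apply, Matrix.sum_apply, Matrix.vecMulVec_apply]

/-- Decompositions of the two operators, put side by side, decompose the sum. -/
theorem gRoof_add_le (hσ : σ.PosSemidef) (hτ : τ.PosSemidef) :
    gRoof (σ + τ) ≤ gRoof σ + gRoof τ := by
  rw [← sub_le_iff_le_add]
  refine le_csInf (roofValues_nonempty hσ) ?_
  rintro _ ⟨r, φ, hφ, rfl⟩
  rw [sub_le_iff_le_add, ← sub_le_iff_le_add']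
  refine le_csInf (roofValues_nonempty hτ) ?_
  rintro _ ⟨s, χ, hχ, rfl⟩
  rw [sub_le_iff_le_add']
  refine gRoof_le ?_
  have := sum_mem_roofValues (σ := σ + τ) (Sum.elim φ χ) (by simp [hφ, hχ])
  simpa using this

/-- A map that acts on vectors and scales the G-concurrence by at most `w` does the same on the
convex roof. -/
theorem gRoof_conj_le {d' e' : ℕ} (hσ : σ.PosSemidef)
    (T : Matrix (Fin d' × Fin e') (Fin d × Fin e) ℂ) {w : ℝ} (hw : 0 ≤ w)
    (hT : ∀ ψ, pureGConcurrence (T *ᵥ ψ) ≤ w * pureGConcurrence ψ) :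
    gRoof (T * σ * Tᴴ) ≤ w * gRoof σ := by
  have key : ∀ g ∈ roofValues σ, gRoof (T * σ * Tᴴ) ≤ w * g := by
    rintro _ ⟨r, φ, hφ, rfl⟩
    refine (gRoof_le (sum_mem_roofValues (fun i => T *ᵥ φ i) ?_)).trans ?_
    · rw [hφ, Matrix.mul_sum, Matrix.sum_mul]
      simp only [Matrix.mul_vecMulVec, Matrix.vecMulVec_mul, Matrix.star_mulVec]
    · rw [Finset.mul_sum]
      exact Finset.sum_le_sum fun i _ => hT _
  -- One cannot divide by `w = 0`, but then any single decomposition gives the bound.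
  rcases hw.eq_or_lt with rfl | hw
  · obtain ⟨g, hg⟩ := roofValues_nonempty hσ
    simpa using key g hg
  · rw [← div_le_iff₀' hw]
    exact le_csInf (roofValues_nonempty hσ) fun g hg => (div_le_iff₀' hw).2 (key g hg)

theorem gRoof_smul_le (hσ : σ.PosSemidef) {c : ℝ} (hc : 0 ≤ c) :
    gRoof ((c : ℂ) • σ) ≤ c * gRoof σ := by
  have hs : ((√c : ℝ) : ℂ) * ((√c : ℝ) : ℂ) = c := by
    rw [← Complex.ofReal_mul, Real.mul_self_sqrt hc]
  have h := gRoof_conj_le (w := c) hσ (((√c : ℝ) : ℂ) • (1 : Matrix _ _ ℂ)) hc (fun ψ => by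
    rw [Matrix.smul_mulVec, Matrix.one_mulVec, pureGConcurrence_smul, Complex.norm_real,
      Real.norm_eq_abs, sq_abs, Real.sq_sqrt hc])
  rwa [Matrix.smul_mul, Matrix.conjTranspose_smul, Matrix.mul_smul, Matrix.smul_mul, smul_smul,
    Matrix.one_mul, Matrix.conjTranspose_one, Matrix.mul_one, Complex.star_def,
    Complex.conj_ofReal, hs] at h

/-- The converse inequality is the first one for the factor `c⁻¹`. -/
theorem gRoof_smul (hσ : σ.PosSemidef) {c : ℝ} (hc : 0 ≤ c) :
    gRoof ((c : ℂ) • σ) = c * gRoof σ := by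
  refine (gRoof_smul_le hσ hc).antisymm ?_
  rcases hc.eq_or_lt with rfl | hc
  · simpa using gRoof_nonneg
  have h := gRoof_smul_le (hσ.smul (Complex.zero_le_real.2 hc.le)) (inv_nonneg.2 hc.le)
  rw [smul_smul, ← Complex.ofReal_mul, inv_mul_cancel₀ hc.ne', Complex.ofReal_one, one_smul] at h
  rwa [← div_eq_inv_mul, le_div_iff₀' hc] at h

theorem trace_vecMulVec_star_re {ι : Type*} [Fintype ι] (φ : ι → ℂ) :
    (Matrix.vecMulVec φ (star φ)).trace.re = ∑ x, ‖φ x‖ ^ 2 := by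
  simp only [Matrix.trace, Matrix.diag, Matrix.vecMulVec_apply, Pi.star_apply, Complex.re_sum]
  refine Finset.sum_congr rfl fun i _ => ?_
  rw [← Complex.ofReal_re (‖φ i‖ ^ 2)]
  congr 1
  have := Complex.mul_conj' (φ i)
  push_cast
  exact this

theorem gRoof_le_trace (hσ : σ.PosSemidef) : gRoof σ ≤ σ.trace.re := by
  obtain ⟨_, r, φ, hφ, rfl⟩ := roofValues_nonempty hσ
  refine (gRoof_le ⟨r, φ, hφ, rfl⟩).trans ?_
  rw [hφ, Matrix.trace_sum, Complex.re_sum]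
  exact Finset.sum_le_sum fun i _ =>
    (pureGConcurrence_le _).trans_eq (trace_vecMulVec_star_re _).symm

theorem exists_unit_smul {ι : Type*} [Fintype ι] [Nonempty ι] (φ : ι → ℂ) :
    ∃ ψ : ι → ℂ, ∑ x, ‖ψ x‖ ^ 2 = 1 ∧ φ = ((√(∑ x, ‖φ x‖ ^ 2) : ℝ) : ℂ) • ψ := by
  classical
  have h0 : 0 ≤ ∑ x, ‖φ x‖ ^ 2 := by positivity
  rcases h0.eq_or_lt with h | h
  · obtain ⟨i⟩ := ‹Nonempty ι›
    refine ⟨Pi.single i 1, ?_, ?_⟩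
    · rw [Finset.sum_eq_single i] <;> simp +contextual
    · rw [← h]
      have := (Finset.sum_eq_zero_iff_of_nonneg (fun x _ => by positivity)).1 h.symm
      ext x
      simpa using this x (Finset.mem_univ x)
  · have hs := Real.sqrt_pos.2 h
    refine ⟨((√(∑ x, ‖φ x‖ ^ 2) : ℝ) : ℂ)⁻¹ • φ, ?_, ?_⟩
    · simp only [Pi.smul_apply, smul_eq_mul, norm_mul, mul_pow, ← Finset.mul_sum, norm_inv,
        Complex.norm_real, Real.norm_eq_abs, inv_pow, sq_abs, Real.sq_sqrt h0]
      exact inv_mul_cancel₀ h.ne'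
    · rw [smul_smul, mul_inv_cancel₀ (by exact_mod_cast hs.ne'), one_smul]

theorem vecMulVec_smul_star {ι : Type*} (c : ℝ) (hc : 0 ≤ c) (ψ : ι → ℂ) :
    Matrix.vecMulVec (((√c : ℝ) : ℂ) • ψ) (star (((√c : ℝ) : ℂ) • ψ)) =
      (c : ℂ) • Matrix.vecMulVec ψ (star ψ) := by
  have hs : ((√c : ℝ) : ℂ) * ((√c : ℝ) : ℂ) = c := by
    rw [← Complex.ofReal_mul, Real.mul_self_sqrt hc]
  ext x y
  simp only [Matrix.vecMulVec_apply, Pi.smul_apply, Pi.star_apply, smul_eq_mul, star_mul',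
    Matrix.smul_apply, ← hs, Complex.star_def, Complex.conj_ofReal]
  ring

/-- On normalized states the extended convex roof is the G-concurrence. -/
theorem gConcurrence_eq_gRoof (hσ : IsState σ) : gConcurrence σ = gRoof σ := by
  unfold gConcurrence gRoof
  congr 1
  ext g
  -- Trace one rules out the empty system, on which no unit vector exists.
  have hne : Nonempty (Fin d × Fin e) := by
    by_contra h
    rw [not_nonempty_iff] at h
    have := hσ.2
    simp [Matrix.trace] at this
  have hG (c : ℝ) (hc : 0 ≤ c) (ψ : Fin d × Fin e → ℂ) :
      pureGConcurrence (((√c : ℝ) : ℂ) • ψ) = c * pureGConcurrence ψ := by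
    rw [pureGConcurrence_smul, Complex.norm_real, Real.norm_eq_abs, sq_abs, Real.sq_sqrt hc]
  constructor
  · rintro ⟨r, p, ψ, ⟨hp, -, -, h⟩, rfl⟩
    refine ⟨r, fun i => ((√(p i) : ℝ) : ℂ) • ψ i, ?_, ?_⟩
    · rw [h]
      exact Finset.sum_congr rfl fun i _ => (vecMulVec_smul_star _ (hp i) _).symm
    · exact Finset.sum_congr rfl fun i _ => (hG _ (hp i) _).symm
  · rintro ⟨r, φ, h, rfl⟩
    choose ψ hψ hφ using fun i => exists_unit_smul (φ i)
    have hp (i) : 0 ≤ ∑ x, ‖φ i x‖ ^ 2 := by positivity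
    -- The squared norms serve as probabilities; they add up to the trace.
    refine ⟨r, fun i => ∑ x, ‖φ i x‖ ^ 2, ψ, ⟨hp, ?_, hψ, ?_⟩, ?_⟩
    · have := congrArg Complex.re hσ.2
      rw [h, Matrix.trace_sum, Complex.re_sum] at this
      simpa only [trace_vecMulVec_star_re, Complex.one_re] using this
    · rw [h]
      refine Finset.sum_congr rfl fun i _ => ?_
      conv_lhs => rw [hφ i]
      exact vecMulVec_smul_star _ (hp i) _
    · refine Finset.sum_congr rfl fun i _ => ?_
      conv_lhs => rw [hφ i]
      exact hG _ (hp i) _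

end Roof

/-! ### Infinite matrices and the weight of an operator -/

/-- The `e × d` corner of an infinite matrix. -/
def corner (e d : ℕ) (K : ℕ → ℕ → ℂ) : Matrix (Fin e) (Fin d) ℂ :=
  Matrix.of fun i j => K i j

/-- The extension by zero of a matrix to an infinite matrix. -/
def extend {m e : ℕ} (C : Matrix (Fin m) (Fin e) ℂ) (i j : ℕ) : ℂ :=
  if h : i < m ∧ j < e then C ⟨i, h.1⟩ ⟨j, h.2⟩ else 0

/-- The product of two infinite matrices along the first `e` inner indices. -/
def cornerMul (e : ℕ) (C K : ℕ → ℕ → ℂ) (i j : ℕ) : ℂ := ∑ k : Fin e, C i k * K k j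

@[simp]
theorem extend_val {m e : ℕ} (C : Matrix (Fin m) (Fin e) ℂ) (i : Fin m) (j : Fin e) :
    extend C i j = C i j := by
  simp [extend]

@[simp]
theorem corner_extend {m e : ℕ} (C : Matrix (Fin m) (Fin e) ℂ) : corner m e (extend C) = C := by
  ext i j
  simp [corner]

theorem corner_cornerMul (m e d : ℕ) (C K : ℕ → ℕ → ℂ) :
    corner m d (cornerMul e C K) = corner m e C * corner e d K := by
  ext i j
  simp [corner, cornerMul, Matrix.mul_apply]

/-- The normalized trace of `K† K`. -/
noncomputable def weight (e d : ℕ) (K : ℕ → ℕ → ℂ) : ℝ :=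
  ((corner e d K)ᴴ * corner e d K).trace.re / d

theorem weight_nonneg (e d : ℕ) (K : ℕ → ℕ → ℂ) : 0 ≤ weight e d K := by
  rw [weight, trace_conjTranspose_mul_self_re]
  positivity

/-- Completeness collapses the sum of `C† C` between `K†` and `K`, and the divisor `d`, the input
dimension of `K`, is common to all terms. -/
theorem sum_weight_kraus {e d : ℕ} (I : Instrument e) (K : ℕ → ℕ → ℂ) :
    ∑ j, ∑ k, weight (I.outDim j) d (cornerMul e (extend (I.kraus j k)) K) = weight e d K := by
  simp only [weight, ← Finset.sum_div, ← Complex.re_sum, ← Matrix.trace_sum, corner_cornerMul,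
    corner_extend]
  congr 3
  calc _ = (corner e d K)ᴴ * (∑ j, ∑ k, (I.kraus j k)ᴴ * I.kraus j k) * corner e d K := by
        simp only [Matrix.mul_sum, Matrix.sum_mul, Matrix.conjTranspose_mul, Matrix.mul_assoc]
    _ = _ := by rw [I.complete, Matrix.mul_one]

/-! ### Operators on one party -/

section Operators

variable {n : ℕ}

/-- The configuration with the entry `k` at the party `p` and the entries of `y` elsewhere. -/
def patch {dims dims' : Fin n → ℕ} (p : Fin n) (hd : ∀ j, j ≠ p → dims' j = dims j)
    (y : Config dims) (k : Fin (dims' p)) : Config dims' :=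
  fun j => if h : j = p then Fin.cast (by rw [h]) k else Fin.cast (hd j h).symm (y j)

section Patch

variable {dims dims' : Fin n → ℕ} {p : Fin n} {hd : ∀ j, j ≠ p → dims' j = dims j}

@[simp]
theorem patch_self (y : Config dims) (k : Fin (dims' p)) : patch p hd y k p = k := by
  simp [patch]

theorem patch_of_ne (y : Config dims) (k : Fin (dims' p)) {j : Fin n} (h : j ≠ p) :
    (patch p hd y k j : ℕ) = y j := by
  simp [patch, h]

theorem eq_patch_iff {x : Config dims'} {y : Config dims} {k : Fin (dims' p)} :
    x = patch p hd y k ↔ (∀ j, j ≠ p → (x j : ℕ) = y j) ∧ x p = k := by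
  constructor
  · rintro rfl
    exact ⟨fun j hj => patch_of_ne y k hj, patch_self y k⟩
  · rintro ⟨h, rfl⟩
    funext j
    by_cases hj : j = p
    · subst hj
      simp
    · exact Fin.ext ((h j hj).trans (patch_of_ne y _ hj).symm)

/-- A sum over the configurations that agree with `y` away from `p`. -/
theorem sum_agree (hd : ∀ j, j ≠ p → dims' j = dims j) (y : Config dims) (F : Config dims' → ℂ) :
    (∑ x, if ∀ j, j ≠ p → (x j : ℕ) = y j then F x else 0) = ∑ k, F (patch p hd y k) := by
  rw [← Finset.sum_filter]
  refine Finset.sum_bij' (fun x _ => x p) (fun k _ => patch p hd y k) (by simp) ?_ ?_ (by simp) ?_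
  · intro k _
    simp only [Finset.mem_filter, Finset.mem_univ, true_and]
    exact fun j hj => patch_of_ne y k hj
  · intro x hx
    exact (eq_patch_iff.2 ⟨(Finset.mem_filter.1 hx).2, rfl⟩).symm
  · intro x hx
    rw [← eq_patch_iff.2 ⟨(Finset.mem_filter.1 hx).2, rfl⟩]

end Patch

/-- The operator `K` acting on party `p`, tensored with the identity on all the other parties,
between systems whose local dimensions agree away from `p`. -/
def opOn (dims' dims : Fin n → ℕ) (p : Fin n) (K : ℕ → ℕ → ℂ) :
    Matrix (Config dims') (Config dims) ℂ :=
  Matrix.of fun x y => if ∀ j, j ≠ p → (x j : ℕ) = y j then K (x p) (y p) else 0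

theorem localOp_eq_opOn (dims : Fin n → ℕ) (i : Fin n) (m : ℕ)
    (C : Matrix (Fin m) (Fin (dims i)) ℂ) : localOp dims i m C =
      opOn (Function.update dims i m) dims i (extend C) := by
  ext x y
  have := extend_val C (Fin.cast (Function.update_self i m dims) (x i)) (y i)
  rw [Fin.val_cast] at this
  simp only [localOp, opOn, Matrix.of_apply, this]

theorem mul_opOn_apply {ι : Type*} {dims' dims : Fin n → ℕ} {p : Fin n}
    (hd : ∀ j, j ≠ p → dims' j = dims j) (M : Matrix ι (Config dims') ℂ) (K : ℕ → ℕ → ℂ)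
    (u : ι) (y : Config dims) :
    (M * opOn dims' dims p K) u y =
      ∑ k : Fin (dims' p), M u (patch p hd y k) * K k (y p) := by
  have := sum_agree hd y (fun x => M u x * K (x p) (y p))
  simp only [patch_self] at this
  rw [← this, Matrix.mul_apply]
  refine Finset.sum_congr rfl fun x _ => ?_
  rw [opOn, Matrix.of_apply, mul_ite, mul_zero]

theorem opOn_mul_opOn_self {dims'' dims' dims : Fin n → ℕ} {p : Fin n}
    (hd : ∀ j, j ≠ p → dims' j = dims j) (C K : ℕ → ℕ → ℂ) :
    opOn dims'' dims' p C *
      opOn dims' dims p K = opOn dims'' dims p (cornerMul (dims' p) C K) := by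
  ext x y
  rw [mul_opOn_apply hd]
  have h (k) : (∀ j, j ≠ p → (x j : ℕ) = patch p hd y k j) ↔ ∀ j, j ≠ p → (x j : ℕ) = y j :=
    forall₂_congr fun j hj => by rw [patch_of_ne y k hj]
  simp only [opOn, Matrix.of_apply, h, patch_self, cornerMul]
  split_ifs <;> simp

theorem opOn_mul_opOn_apply {dims'' dims' dims : Fin n → ℕ} {i p : Fin n} (hip : i ≠ p)
    (hd' : ∀ j, j ≠ i → dims'' j = dims' j) (hd : ∀ j, j ≠ p → dims' j = dims j)
    (C K : ℕ → ℕ → ℂ) (x : Config dims'') (y : Config dims) :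
    (opOn dims'' dims' i C *
      opOn dims' dims p K) x y =
      if ∀ j, j ≠ i → j ≠ p → (x j : ℕ) = y j then C (x i) (y i) * K (x p) (y p) else 0 := by
  -- The left factor is diagonal at `p`, so the intermediate entry there must be that of `x`.
  rw [mul_opOn_apply hd, Finset.sum_eq_single (Fin.cast (hd' p hip.symm) (x p))]
  · have h : (∀ j, j ≠ i → (x j : ℕ) = patch p hd y (Fin.cast (hd' p hip.symm) (x p)) j) ↔
        ∀ j, j ≠ i → j ≠ p → (x j : ℕ) = y j := by
      refine forall₂_congr fun j _ => ?_
      by_cases hj : j = p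
      · subst hj
        simp
      · simp [patch_of_ne y _ hj, hj]
    simp only [opOn, Matrix.of_apply, h, patch_of_ne y _ hip, Fin.val_cast]
    split_ifs <;> simp
  · intro k _ hk
    rw [opOn, Matrix.of_apply, if_neg, zero_mul]
    intro h
    have := h p hip.symm
    rw [patch_self] at this
    exact hk (Fin.ext this.symm)
  · simp

/-- Operators on different parties commute. -/
theorem opOn_comm {d₁ d₂ d₃ d₄ : Fin n → ℕ} {i p : Fin n} (hip : i ≠ p)
    (h₁₂ : ∀ j, j ≠ p → d₂ j = d₁ j) (h₂₄ : ∀ j, j ≠ i → d₄ j = d₂ j)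
    (h₁₃ : ∀ j, j ≠ i → d₃ j = d₁ j) (h₃₄ : ∀ j, j ≠ p → d₄ j = d₃ j) (C K : ℕ → ℕ → ℂ) :
    opOn d₄ d₂ i C * opOn d₂ d₁ p K =
      opOn d₄ d₃ p K *
        opOn d₃ d₁ i C := by
  ext x y
  rw [opOn_mul_opOn_apply hip h₂₄ h₁₂, opOn_mul_opOn_apply hip.symm h₃₄ h₁₃]
  have h : (∀ j, j ≠ p → j ≠ i → (x j : ℕ) = y j) ↔ ∀ j, j ≠ i → j ≠ p → (x j : ℕ) = y j :=
    forall_congr' fun j => ⟨fun h a b => h b a, fun h a b => h b a⟩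
  simp only [h, mul_comm]

theorem opOn_delta (dims : Fin n → ℕ) (p : Fin n) :
    opOn dims dims p (fun i j => if i = j then 1 else 0) = 1 := by
  ext x y
  rw [opOn, Matrix.of_apply, Matrix.one_apply, ← ite_and]
  refine if_congr ?_ rfl rfl
  constructor
  · rintro ⟨h, h'⟩
    funext j
    by_cases hj : j = p
    · subst hj
      exact Fin.ext h'
    · exact Fin.ext (h j hj)
  · rintro rfl
    simp

theorem weight_delta {d : ℕ} (hd : 0 < d) : weight d d (fun i j => if i = j then 1 else 0) = 1 := by
  have : corner d d (fun i j => if i = j then 1 else 0) = 1 := by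
    ext i j
    simp [corner, Matrix.one_apply, Fin.ext_iff]
  rw [weight, this]
  simp [hd.ne']

theorem opOn_conjTranspose {dims' dims : Fin n → ℕ} (p : Fin n) (K : ℕ → ℕ → ℂ) :
    (opOn dims' dims p K)ᴴ = opOn dims dims' p (fun i j => star (K j i)) := by
  ext x y
  simp only [opOn, Matrix.conjTranspose_apply, Matrix.of_apply, eq_comm]
  split_ifs <;> simp

/-- A local instrument is complete as an operation on all the parties. -/
theorem sum_localOp {dims : Fin n → ℕ} {i : Fin n} (I : Instrument (dims i)) :
    ∑ j, ∑ k, (localOp dims i (I.outDim j) (I.kraus j k))ᴴ *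
      localOp dims i (I.outDim j) (I.kraus j k) = 1 := by
  rw [← opOn_delta dims i]
  simp only [localOp_eq_opOn, opOn_conjTranspose]
  ext x y
  have hd (m : ℕ) : ∀ j, j ≠ i → Function.update dims i m j = dims j :=
    fun j hj => Function.update_of_ne hj _ _
  simp only [opOn_mul_opOn_self (hd _), Matrix.sum_apply]
  simp only [opOn, Matrix.of_apply]
  by_cases h : ∀ j, j ≠ i → (x j : ℕ) = y j
  · have h1 := congrFun (congrFun I.complete (x i)) (y i)
    simp only [Matrix.sum_apply, Matrix.mul_apply, Matrix.conjTranspose_apply,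
      Matrix.one_apply, Fin.ext_iff] at h1
    simp only [if_pos h]
    rw [← h1]
    refine Finset.sum_congr rfl fun j _ => Finset.sum_congr rfl fun k _ => ?_
    rw [cornerMul, Function.update_self]
    simp only [extend_val]
  · simp [if_neg h]

/-! ### Partial traces -/

section Reduced

variable {dims : Fin n → ℕ} {A B : Fin n}

/-- The projection onto the systems `A` and `B` along a basis vector of the other parties. -/
def slice (dims : Fin n → ℕ) (A B : Fin n) (z : Fin n → ℕ) :
    Matrix (Fin (dims A) × Fin (dims B)) (Config dims) ℂ :=
  Matrix.of fun u x => if (x A, x B) = u ∧ ∀ j, j ≠ A → j ≠ B → (x j : ℕ) = z j then 1 else 0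

/-- The basis labels of the parties other than `A` and `B`. -/
def envLabels (dims : Fin n → ℕ) (A B : Fin n) : Finset (Fin n → ℕ) :=
  Fintype.piFinset fun j => if j = A ∨ j = B then {0} else Finset.range (dims j)

theorem envLabels_congr {dims' : Fin n → ℕ} (h : ∀ j, j ≠ A → j ≠ B → dims' j = dims j) :
    envLabels dims' A B = envLabels dims A B := by
  unfold envLabels
  congr 1
  funext j
  split_ifs with hj
  · rfl
  · push Not at hj
    rw [h j hj.1 hj.2]

/-- The basis label of the environment in a configuration. -/
def envLabel (A B : Fin n) (x : Config dims) (j : Fin n) : ℕ :=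
  if j = A ∨ j = B then 0 else x j

theorem eq_envLabel_iff {x : Config dims} {z : Fin n → ℕ} (hz : z ∈ envLabels dims A B) :
    (∀ j, j ≠ A → j ≠ B → (x j : ℕ) = z j) ↔ z = envLabel A B x := by
  rw [envLabels, Fintype.mem_piFinset] at hz
  rw [funext_iff]
  refine forall_congr' fun j => ?_
  have := hz j
  unfold envLabel
  split_ifs at this ⊢ with h
  · simp only [Finset.mem_singleton] at this
    simp only [this, iff_true]
    rcases h with h | h <;> simp [h]
  · push Not at h
    simp [h, eq_comm]

theorem envLabel_mem (x : Config dims) : envLabel A B x ∈ envLabels dims A B := by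
  rw [envLabels, Fintype.mem_piFinset]
  intro j
  unfold envLabel
  split_ifs <;> simp

/-- The Kraus form of the partial trace: it gives linearity and positivity, and reduces commutation
with local operators to a single `slice`. -/
theorem reducedState_eq_sum (ρ : Operator dims) :
    reducedState A B ρ = ∑ z ∈ envLabels dims A B, slice dims A B z * ρ * (slice dims A B z)ᴴ := by
  classical
  ext u v
  simp only [Matrix.sum_apply, Matrix.mul_apply, Finset.sum_mul, Matrix.conjTranspose_apply]
  rw [Finset.sum_comm]
  simp only [reducedState, Matrix.of_apply]
  rw [Finset.sum_comm]
  refine Finset.sum_congr rfl fun y _ => ?_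
  rw [Finset.sum_comm]
  refine Finset.sum_congr rfl fun x _ => ?_
  -- For fixed `x` only its own environment label contributes.
  rw [Finset.sum_eq_single_of_mem _ (envLabel_mem x)]
  · have h1 := (eq_envLabel_iff (x := x) (envLabel_mem (A := A) (B := B) x)).2 rfl
    have h2 : (∀ j, j ≠ A → j ≠ B → (y j : ℕ) = envLabel A B x j) ↔
        ∀ j, j ≠ A → j ≠ B → x j = y j :=
      forall_congr' fun j => forall₂_congr fun hA hB => by
        rw [← h1 j hA hB, Fin.ext_iff, eq_comm]
    simp only [slice, Matrix.of_apply, h2]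
    by_cases hu : (x A, x B) = u
    · by_cases hv : (y A, y B) = v ∧ ∀ j, j ≠ A → j ≠ B → x j = y j
      · rw [if_pos ⟨hu, hv⟩, if_pos ⟨hu, h1⟩, if_pos hv]
        simp
      · rw [if_neg (fun h => hv h.2), if_neg hv]
        simp
    · rw [if_neg (fun h => hu h.1), if_neg (fun h => hu h.1)]
      simp
  · intro z hz hne
    have : ¬ ((x A, x B) = u ∧ ∀ j, j ≠ A → j ≠ B → (x j : ℕ) = z j) :=
      fun h => hne ((eq_envLabel_iff hz).1 h.2)
    simp only [slice, Matrix.of_apply, if_neg this, zero_mul]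

theorem reducedState_add (ρ σ : Operator dims) :
    reducedState A B (ρ + σ) = reducedState A B ρ + reducedState A B σ := by
  simp only [reducedState_eq_sum, Matrix.mul_add, Matrix.add_mul, Finset.sum_add_distrib]

theorem reducedState_smul (c : ℂ) (ρ : Operator dims) :
    reducedState A B (c • ρ) = c • reducedState A B ρ := by
  simp only [reducedState_eq_sum, Matrix.mul_smul, Matrix.smul_mul, Finset.smul_sum]

theorem posSemidef_reducedState {ρ : Operator dims} (hρ : ρ.PosSemidef) :
    (reducedState A B ρ).PosSemidef := by
  rw [reducedState_eq_sum]
  exact Matrix.posSemidef_sum _ fun z _ => hρ.mul_mul_conjTranspose_same _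

theorem trace_reducedState (ρ : Operator dims) : (reducedState A B ρ).trace = ρ.trace := by
  simp only [Matrix.trace, Matrix.diag, reducedState, Matrix.of_apply]
  rw [Finset.sum_comm]
  refine Finset.sum_congr rfl fun x _ => ?_
  rw [Finset.sum_comm, Finset.sum_eq_single x]
  · rw [Finset.sum_eq_single (x A, x B)]
    · simp
    · intro u _ hu
      rw [if_neg fun h => hu h.1.symm]
    · simp
  · intro y _ hy
    refine Finset.sum_eq_zero fun u _ => if_neg ?_
    rintro ⟨h1, h2, h3⟩
    refine hy (funext fun j => ?_)
    have h4 := h1.trans h2.symm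
    simp only [Prod.mk.injEq] at h4
    by_cases hA : j = A
    · subst hA
      exact h4.1.symm
    by_cases hB : j = B
    · subst hB
      exact h4.2.symm
    exact (h3 j hA hB).symm
  · simp

end Reduced

/-! ### Local operators of A and B on their reduced state -/

/-- `K ⊗ 1` on a bipartite system. -/
def opLeft (d e d' e' : ℕ) (K : ℕ → ℕ → ℂ) : Matrix (Fin d' × Fin e') (Fin d × Fin e) ℂ :=
  Matrix.of fun u v => if (u.2 : ℕ) = v.2 then K u.1 v.1 else 0

/-- `1 ⊗ K` on a bipartite system. -/
def opRight (d e d' e' : ℕ) (K : ℕ → ℕ → ℂ) : Matrix (Fin d' × Fin e') (Fin d × Fin e) ℂ :=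
  Matrix.of fun u v => if (u.1 : ℕ) = v.1 then K u.2 v.2 else 0

section ReducedConj

variable {dims dims' : Fin n → ℕ} {A B : Fin n}

theorem slice_mul_opOn_left (hAB : A ≠ B) (hd : ∀ j, j ≠ A → dims' j = dims j) (K : ℕ → ℕ → ℂ)
    (z : Fin n → ℕ) :
    slice dims' A B z * opOn dims' dims A K =
      opLeft (dims A) (dims B) (dims' A) (dims' B) K * slice dims A B z := by
  ext u y
  rw [mul_opOn_apply hd, Finset.sum_eq_single u.1, Matrix.mul_apply,
    Finset.sum_eq_single (y A, y B)]
  · simp only [slice, opLeft, Matrix.of_apply, patch_self, true_and]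
    have h1 : (∀ j, j ≠ A → j ≠ B → (patch A hd y u.1 j : ℕ) = z j) ↔
        ∀ j, j ≠ A → j ≠ B → (y j : ℕ) = z j :=
      forall₂_congr fun j hj => by rw [patch_of_ne y _ hj]
    have h2 : (u.1, patch A hd y u.1 B) = u ↔ (u.2 : ℕ) = y B := by
      rw [Prod.ext_iff, Fin.ext_iff (b := u.2), patch_of_ne y _ hAB.symm]
      simp [eq_comm]
    simp only [h1, h2]
    split_ifs <;> simp_all
  · intro v _ hv
    rw [slice, Matrix.of_apply, if_neg fun h => hv h.1.symm, mul_zero]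
  · simp
  · intro k _ hk
    rw [slice, Matrix.of_apply, if_neg, zero_mul]
    rintro ⟨h, -⟩
    exact hk (by simpa using congrArg Prod.fst h)
  · simp

theorem slice_mul_opOn_right (hAB : A ≠ B) (hd : ∀ j, j ≠ B → dims' j = dims j) (K : ℕ → ℕ → ℂ)
    (z : Fin n → ℕ) :
    slice dims' A B z * opOn dims' dims B K =
      opRight (dims A) (dims B) (dims' A) (dims' B) K * slice dims A B z := by
  ext u y
  rw [mul_opOn_apply hd, Finset.sum_eq_single u.2, Matrix.mul_apply,
    Finset.sum_eq_single (y A, y B)]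
  · simp only [slice, opRight, Matrix.of_apply, patch_self, true_and]
    have h1 : (∀ j, j ≠ A → j ≠ B → (patch B hd y u.2 j : ℕ) = z j) ↔
        ∀ j, j ≠ A → j ≠ B → (y j : ℕ) = z j :=
      forall_congr' fun j => forall₂_congr fun _ hj => by rw [patch_of_ne y _ hj]
    have h2 : (patch B hd y u.2 A, u.2) = u ↔ (u.1 : ℕ) = y A := by
      rw [Prod.ext_iff, Fin.ext_iff (b := u.1), patch_of_ne y _ hAB]
      simp [eq_comm]
    simp only [h1, h2]
    split_ifs <;> simp_all
  · intro v _ hv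
    rw [slice, Matrix.of_apply, if_neg fun h => hv h.1.symm, mul_zero]
  · simp
  · intro k _ hk
    rw [slice, Matrix.of_apply, if_neg, zero_mul]
    rintro ⟨h, -⟩
    exact hk (by simpa using congrArg Prod.snd h)
  · simp

theorem reducedState_opOn_left (hAB : A ≠ B) (hd : ∀ j, j ≠ A → dims' j = dims j)
    (K : ℕ → ℕ → ℂ) (τ : Operator dims) :
    reducedState A B (opOn dims' dims A K * τ * (opOn dims' dims A K)ᴴ) =
      opLeft (dims A) (dims B) (dims' A) (dims' B) K * reducedState A B τ *
        (opLeft (dims A) (dims B) (dims' A) (dims' B) K)ᴴ := by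
  rw [reducedState_eq_sum, reducedState_eq_sum, envLabels_congr fun j hA _ => hd j hA,
    Matrix.mul_sum, Matrix.sum_mul]
  refine Finset.sum_congr rfl fun z _ => ?_
  have h := slice_mul_opOn_left (B := B) hAB hd K z
  calc _ = (slice dims' A B z * opOn dims' dims A K) * τ *
          (slice dims' A B z * opOn dims' dims A K)ᴴ := by
        simp only [Matrix.conjTranspose_mul, Matrix.mul_assoc]
    _ = _ := by
        rw [h]
        simp only [Matrix.conjTranspose_mul, Matrix.mul_assoc]

theorem reducedState_opOn_right (hAB : A ≠ B) (hd : ∀ j, j ≠ B → dims' j = dims j)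
    (K : ℕ → ℕ → ℂ) (τ : Operator dims) :
    reducedState A B (opOn dims' dims B K * τ * (opOn dims' dims B K)ᴴ) =
      opRight (dims A) (dims B) (dims' A) (dims' B) K * reducedState A B τ *
        (opRight (dims A) (dims B) (dims' A) (dims' B) K)ᴴ := by
  rw [reducedState_eq_sum, reducedState_eq_sum, envLabels_congr fun j _ hB => hd j hB,
    Matrix.mul_sum, Matrix.sum_mul]
  refine Finset.sum_congr rfl fun z _ => ?_
  have h := slice_mul_opOn_right (A := A) hAB hd K z
  calc _ = (slice dims' A B z * opOn dims' dims B K) * τ *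
          (slice dims' A B z * opOn dims' dims B K)ᴴ := by
        simp only [Matrix.conjTranspose_mul, Matrix.mul_assoc]
    _ = _ := by
        rw [h]
        simp only [Matrix.conjTranspose_mul, Matrix.mul_assoc]

end ReducedConj

/-- A local operator on a `d × d` system scales the G-concurrence by `|det K| ^ (2 / d)`, which is
at most the weight of `K`. -/
theorem pureGConcurrence_le_weight_mul {d : ℕ} {K : ℕ → ℕ → ℂ} {φ ψ : Fin d × Fin d → ℂ}
    (h : (coeffMatrix φ).det = (corner d d K).det * (coeffMatrix ψ).det) :
    pureGConcurrence φ ≤ weight d d K * pureGConcurrence ψ := by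
  rcases Nat.eq_zero_or_pos d with rfl | hd
  · simp [pureGConcurrence]
  rw [pureGConcurrence_of_det_eq h]
  refine mul_le_mul_of_nonneg_right ?_ (pureGConcurrence_nonneg _)
  rw [weight, le_div_iff₀' (by exact_mod_cast hd), ← det_conjTranspose_mul_self_re]
  exact card_mul_det_rpow_le_trace (Matrix.posSemidef_conjTranspose_mul_self _)

theorem pureGConcurrence_of_ne {d e : ℕ} (h : d ≠ e) (ψ : Fin d × Fin e → ℂ) :
    pureGConcurrence ψ = 0 := by
  rw [pureGConcurrence, if_neg h]

theorem pureGConcurrence_opLeft_le {d e d' e' : ℕ} (hd : d' = d) (he : e' = e) (K : ℕ → ℕ → ℂ)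
    (ψ : Fin d × Fin e → ℂ) :
    pureGConcurrence (opLeft d e d' e' K *ᵥ ψ) ≤
      weight d' d K * pureGConcurrence ψ := by
  subst hd he
  by_cases h : d' = e'
  · subst h
    refine pureGConcurrence_le_weight_mul ?_
    rw [← Matrix.det_mul]
    congr 1
    ext i j
    simp [coeffMatrix, corner, opLeft, Matrix.mulVec, dotProduct, Matrix.mul_apply,
      Fintype.sum_prod_type, ← Fin.ext_iff]
  · simp [pureGConcurrence_of_ne h]

theorem pureGConcurrence_opRight_le {d e d' e' : ℕ} (hd : d' = d) (he : e' = e) (K : ℕ → ℕ → ℂ)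
    (ψ : Fin d × Fin e → ℂ) :
    pureGConcurrence (opRight d e d' e' K *ᵥ ψ) ≤
      weight e' e K * pureGConcurrence ψ := by
  subst hd he
  by_cases h : d' = e'
  · subst h
    refine pureGConcurrence_le_weight_mul ?_
    -- On the second factor `K` acts by right multiplication with its transpose.
    rw [← Matrix.det_transpose (corner d' d' K), mul_comm, ← Matrix.det_mul]
    congr 1
    ext i j
    simp [coeffMatrix, corner, opRight, Matrix.mulVec, dotProduct, Matrix.mul_apply,
      Fintype.sum_prod_type, ← Fin.ext_iff, Finset.sum_ite_irrel, mul_comm]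
  · simp [pureGConcurrence_of_ne h]

/-- Operating on one of the parties `A` and `B` with `K` scales the G-concurrence that they share
by at most the weight of `K`. -/
theorem gRoof_reducedState_opOn_le {dims dims' : Fin n → ℕ} {A B p : Fin n} (hAB : A ≠ B)
    (hp : p = A ∨ p = B) (hd : ∀ j, j ≠ p → dims' j = dims j) (hdp : dims' p = dims p)
    (K : ℕ → ℕ → ℂ) {τ : Operator dims} (hτ : τ.PosSemidef) :
    gRoof (reducedState A B (opOn dims' dims p K * τ * (opOn dims' dims p K)ᴴ)) ≤
      weight (dims' p) (dims p) K * gRoof (reducedState A B τ) := by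
  have hall (j) : dims' j = dims j := by
    by_cases h : j = p
    · rw [h, hdp]
    · exact hd j h
  rcases hp with rfl | rfl
  · rw [reducedState_opOn_left hAB hd]
    exact gRoof_conj_le (posSemidef_reducedState hτ) _ (weight_nonneg _ _ _)
      (pureGConcurrence_opLeft_le (hall _) (hall _) K)
  · rw [reducedState_opOn_right hAB hd]
    exact gRoof_conj_le (posSemidef_reducedState hτ) _ (weight_nonneg _ _ _)
      (pureGConcurrence_opRight_le (hall _) (hall _) K)

end Operators

/-! ### Averages over protocols, without normalization -/

section Protocols

variable {n : ℕ}

section Apply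

variable {dims : Fin n → ℕ} {i : Fin n}

theorem Instrument.posSemidef_apply (I : Instrument (dims i)) (j : Fin I.outcomes)
    {ρ : Operator dims} (hρ : ρ.PosSemidef) : (I.apply j ρ).PosSemidef :=
  Matrix.posSemidef_sum _ fun _ _ => hρ.mul_mul_conjTranspose_same _

theorem Instrument.apply_add (I : Instrument (dims i)) (j : Fin I.outcomes) (ρ σ : Operator dims) :
    I.apply j (ρ + σ) = I.apply j ρ + I.apply j σ := by
  simp only [Instrument.apply, Matrix.mul_add, Matrix.add_mul, Finset.sum_add_distrib]

theorem Instrument.apply_smul (I : Instrument (dims i)) (j : Fin I.outcomes) (c : ℂ)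
    (ρ : Operator dims) : I.apply j (c • ρ) = c • I.apply j ρ := by
  simp only [Instrument.apply, Matrix.mul_smul, Matrix.smul_mul, Finset.smul_sum]

theorem Instrument.sum_trace_apply (I : Instrument (dims i)) (ρ : Operator dims) :
    ∑ j, (I.apply j ρ).trace = ρ.trace := by
  simp only [Instrument.apply, Matrix.trace_sum]
  calc _ = ∑ j, ∑ k, (((localOp dims i (I.outDim j) (I.kraus j k))ᴴ *
          localOp dims i (I.outDim j) (I.kraus j k)) * ρ).trace :=
        Finset.sum_congr rfl fun j _ => Finset.sum_congr rfl fun k _ => by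
          rw [Matrix.trace_mul_comm, Matrix.mul_assoc]
    _ = ((∑ j, ∑ k, (localOp dims i (I.outDim j) (I.kraus j k))ᴴ *
          localOp dims i (I.outDim j) (I.kraus j k)) * ρ).trace := by
        simp only [Matrix.sum_mul, Matrix.trace_sum]
    _ = _ := by rw [sum_localOp, Matrix.one_mul]

end Apply

/-- The average G-concurrence of a protocol, extended homogeneously to unnormalized states. -/
noncomputable def Protocol.rawAverage {S : Set (Fin n)} {A B : Fin n} {a b : ℕ} :
    {dims : Fin n → ℕ} → Protocol S A B a b dims → Operator dims → ℝ
  | _, .done _ _, ρ => gRoof (reducedState A B ρ)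
  | _, .step _ _ I next, ρ => ∑ j, (next j).rawAverage (I.apply j ρ)

namespace Protocol

variable {S : Set (Fin n)} {A B : Fin n} {a b : ℕ} {dims : Fin n → ℕ}

theorem rawAverage_add_le (P : Protocol S A B a b dims) {ρ σ : Operator dims}
    (hρ : ρ.PosSemidef) (hσ : σ.PosSemidef) :
    P.rawAverage (ρ + σ) ≤ P.rawAverage ρ + P.rawAverage σ := by
  induction P with
  | done =>
    rw [rawAverage, rawAverage, rawAverage, reducedState_add]
    exact gRoof_add_le (posSemidef_reducedState hρ) (posSemidef_reducedState hσ)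
  | step i hi I next ih =>
    rw [rawAverage, rawAverage, rawAverage, ← Finset.sum_add_distrib]
    refine Finset.sum_le_sum fun j _ => ?_
    rw [I.apply_add]
    exact ih j (I.posSemidef_apply j hρ) (I.posSemidef_apply j hσ)

theorem rawAverage_smul (P : Protocol S A B a b dims) {ρ : Operator dims} (hρ : ρ.PosSemidef)
    {c : ℝ} (hc : 0 ≤ c) : P.rawAverage ((c : ℂ) • ρ) = c * P.rawAverage ρ := by
  induction P with
  | done =>
    rw [rawAverage, rawAverage, reducedState_smul, gRoof_smul (posSemidef_reducedState hρ) hc]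
  | step i hi I next ih =>
    rw [rawAverage, rawAverage, Finset.mul_sum]
    refine Finset.sum_congr rfl fun j _ => ?_
    rw [I.apply_smul]
    exact ih j (I.posSemidef_apply j hρ)

theorem rawAverage_zero (P : Protocol S A B a b dims) : P.rawAverage 0 = 0 := by
  simpa using P.rawAverage_smul (ρ := 0) Matrix.PosSemidef.zero le_rfl

/-- Lets an outcome be split into its individual Kraus operators, as if they were announced too. -/
theorem rawAverage_sum_le (P : Protocol S A B a b dims) {ι : Type*} (s : Finset ι)
    {ρ : ι → Operator dims} (hρ : ∀ k, (ρ k).PosSemidef) :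
    P.rawAverage (∑ k ∈ s, ρ k) ≤ ∑ k ∈ s, P.rawAverage (ρ k) := by
  classical
  induction s using Finset.induction_on with
  | empty => simp [rawAverage_zero]
  | insert k s hk ih =>
    rw [Finset.sum_insert hk, Finset.sum_insert hk]
    exact (P.rawAverage_add_le (hρ k) (Matrix.posSemidef_sum s fun k _ => hρ k)).trans
      (by gcongr)

theorem rawAverage_le_trace (P : Protocol S A B a b dims) {ρ : Operator dims}
    (hρ : ρ.PosSemidef) : P.rawAverage ρ ≤ ρ.trace.re := by
  induction P with
  | done =>
    rw [rawAverage, ← trace_reducedState (A := A) (B := B) ρ]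
    exact gRoof_le_trace (posSemidef_reducedState hρ)
  | step i hi I next ih =>
    rw [rawAverage, ← I.sum_trace_apply ρ, Complex.re_sum]
    exact Finset.sum_le_sum fun j _ => ih j (I.posSemidef_apply j hρ)

/-- By homogeneity the probability `p` cancels the normalization `p⁻¹` in each round. -/
theorem average_eq_rawAverage (P : Protocol S A B a b dims) {ρ : Operator dims} (hρ : IsState ρ) :
    P.average ρ = P.rawAverage ρ := by
  induction P with
  | done =>
    exact gConcurrence_eq_gRoof ⟨posSemidef_reducedState hρ.1, by rw [trace_reducedState, hρ.2]⟩
  | step i hi I next ih =>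
    rw [average, rawAverage]
    refine Finset.sum_congr rfl fun j _ => ?_
    dsimp only
    have hpos := I.posSemidef_apply j hρ.1
    have htr : (((I.apply j ρ).trace.re : ℝ) : ℂ) = (I.apply j ρ).trace :=
      Complex.ext rfl (Complex.le_def.1 hpos.trace_nonneg).2
    have hp : 0 ≤ (I.apply j ρ).trace.re := (Complex.le_def.1 hpos.trace_nonneg).1
    rcases hp.eq_or_lt with h | h
    · rw [← h, Complex.ofReal_zero] at htr
      -- A positive operator of trace zero is zero, so an outcome of probability zero contributes
      -- nothing on either side.
      simp [hpos.trace_eq_zero_iff.1 htr.symm, rawAverage_zero]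
    · have hinv := inv_nonneg.2 hp
      rw [ih j ⟨hpos.smul (Complex.zero_le_real.2 hinv), ?_⟩, rawAverage_smul _ hpos hinv,
        mul_inv_cancel_left₀ h.ne']
      rw [Matrix.trace_smul, ← htr, smul_eq_mul, ← Complex.ofReal_mul, Complex.ofReal_re,
        inv_mul_cancel₀ h.ne', Complex.ofReal_one]

/-- A protocol remains available when more parties may operate. -/
theorem exists_rawAverage_eq_of_subset {T : Set (Fin n)} (hST : S ⊆ T)
    (P : Protocol S A B a b dims) :
    ∃ P' : Protocol T A B a b dims, ∀ ρ, P'.rawAverage ρ = P.rawAverage ρ := by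
  induction P with
  | done hA hB => exact ⟨.done hA hB, fun _ => rfl⟩
  | step i hi I next ih =>
    choose P' hP' using ih
    refine ⟨.step i (hST hi) I P', fun ρ => ?_⟩
    rw [rawAverage, rawAverage]
    exact Finset.sum_congr rfl fun j _ => hP' j _

end Protocol

/-! ### Removing a party from a protocol -/

/-- The instrument that discards a system and prepares a basis state of another one. -/
def Instrument.reset (e b : ℕ) (hb : 0 < b) : Instrument e where
  outcomes := 1
  outDim _ := b
  krausCount _ := e
  kraus _ k := Matrix.single ⟨0, hb⟩ k 1
  complete := by
    simp only [Matrix.conjTranspose_single, Matrix.single_mul_single_same, star_one, mul_one,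
      Finset.univ_unique, Finset.sum_singleton]
    exact Matrix.sum_single_one

/-- The same instrument on a system whose dimension is given by another expression. -/
abbrev Instrument.copy {d e : ℕ} (I : Instrument d) (h : d = e) : Instrument e where
  outcomes := I.outcomes
  outDim := I.outDim
  krausCount := I.krausCount
  kraus j k := (I.kraus j k).submatrix id (Fin.cast h.symm)
  complete := by
    subst h
    exact I.complete

theorem Instrument.extend_copy {d e : ℕ} (I : Instrument d) (h : d = e) (j : Fin I.outcomes)
    (k : Fin (I.krausCount j)) : extend ((I.copy h).kraus j k) = extend (I.kraus j k) := by
  subst h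
  rfl

/-- If each of the parties `A` and `B` has the required dimension or may operate, then there is
a protocol. -/
theorem Protocol.nonempty {S : Set (Fin n)} {A B : Fin n} (hAB : A ≠ B) {a b : ℕ} (ha : 0 < a)
    (hb : 0 < b) {dims : Fin n → ℕ} (hA : dims A = a ∨ A ∈ S) (hB : dims B = b ∨ B ∈ S) :
    Nonempty (Protocol S A B a b dims) := by
  have key {dims : Fin n → ℕ} (hA : dims A = a) (hB : dims B = b ∨ B ∈ S) :
      Nonempty (Protocol S A B a b dims) := by
    rcases hB with hB | hB
    · exact ⟨.done hA hB⟩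
    · refine ⟨.step B hB (Instrument.reset _ b hb) fun j => .done ?_ ?_⟩
      · rwa [Function.update_of_ne hAB]
      · exact Function.update_self _ _ _
  rcases hA with hA | hA
  · exact key hA hB
  · have h : Nonempty (Protocol S A B a b (Function.update dims A a)) :=
      key (Function.update_self _ _ _) (by rwa [Function.update_of_ne hAB.symm])
    exact ⟨.step A hA (Instrument.reset _ a ha) fun _ => h.some⟩

/-- A local operator can be postponed past an instrument of another party. -/
theorem Instrument.apply_opOn_conj {dims dims' : Fin n → ℕ} {i p : Fin n} (hip : i ≠ p)
    (hd : ∀ j, j ≠ p → dims' j = dims j) (I : Instrument (dims' i)) (j : Fin I.outcomes)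
    (K : ℕ → ℕ → ℂ) (τ : Operator dims) :
    I.apply j (opOn dims' dims p K * τ * (opOn dims' dims p K)ᴴ) =
      opOn (Function.update dims' i (I.outDim j)) (Function.update dims i (I.outDim j)) p K *
        ((I.copy (hd i hip)).apply j τ : Operator (Function.update dims i (I.outDim j))) *
        (opOn (Function.update dims' i (I.outDim j)) (Function.update dims i (I.outDim j)) p K)ᴴ := by
  simp only [Instrument.apply, Matrix.mul_sum, Matrix.sum_mul]
  refine Finset.sum_congr rfl fun k _ => ?_
  have hu {e : Fin n → ℕ} (m : ℕ) : ∀ j, j ≠ i → Function.update e i m j = e j :=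
    fun j hj => Function.update_of_ne hj _ _
  have hup (m : ℕ) : ∀ j, j ≠ p → Function.update dims' i m j = Function.update dims i m j := by
    intro j hj
    by_cases h : j = i
    · subst h
      simp
    · rw [hu m j h, hu m j h, hd j hj]
  have h := opOn_comm hip hd (hu (I.outDim j)) (hu (I.outDim j)) (hup (I.outDim j))
    (extend (I.kraus j k)) K
  have hc : localOp dims i ((I.copy (hd i hip)).outDim j) ((I.copy (hd i hip)).kraus j k) =
      opOn (Function.update dims i (I.outDim j)) dims i (extend (I.kraus j k)) := by
    rw [localOp_eq_opOn, Instrument.extend_copy]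
  rw [localOp_eq_opOn, hc]
  calc _ = (opOn _ dims' i (extend (I.kraus j k)) * opOn dims' dims p K) * τ *
        (opOn _ dims' i (extend (I.kraus j k)) * opOn dims' dims p K)ᴴ := by
        simp only [Matrix.conjTranspose_mul, Matrix.mul_assoc]
    _ = _ := by
        rw [h]
        simp only [Matrix.conjTranspose_mul, Matrix.mul_assoc]

/-- What a protocol achieves after `K` has acted on one of the parties `A` and `B` is achieved, up
to the weight of `K`, without that party operating. -/
theorem Protocol.exists_rawAverage_le {S : Set (Fin n)} {A B p : Fin n} (hAB : A ≠ B)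
    (hp : p = A ∨ p = B) (hpS : p ∉ S) {a b : ℕ} (ha : 0 < a) (hb : 0 < b) {dims' : Fin n → ℕ}
    (P : Protocol (insert p S) A B a b dims') {dims : Fin n → ℕ}
    (hd : ∀ j, j ≠ p → dims' j = dims j) (hA : dims A = a ∨ A ∈ S) (hB : dims B = b ∨ B ∈ S)
    (K : ℕ → ℕ → ℂ) {τ : Operator dims} (hτ : τ.PosSemidef) :
    ∃ P' : Protocol S A B a b dims,
      P.rawAverage (opOn dims' dims p K * τ * (opOn dims' dims p K)ᴴ) ≤
        weight (dims' p) (dims p) K * P'.rawAverage τ := by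
  induction P generalizing dims K with
  | @done dims' hA' hB' =>
    -- At the end `p` has its prescribed dimension, and so it has in `dims`, because `p ∉ S`. Hence
    -- `K` is square and the determinant bound applies.
    have hdp : dims' p = dims p := by
      rcases hp with rfl | rfl
      · rw [hA', hA.resolve_right hpS]
      · rw [hB', hB.resolve_right hpS]
    have hall (j) : dims' j = dims j := by
      by_cases h : j = p
      · rw [h, hdp]
      · exact hd j h
    refine ⟨.done (by rw [← hall, hA']) (by rw [← hall, hB']), ?_⟩
    rw [rawAverage, rawAverage]
    exact gRoof_reducedState_opOn_le hAB hp hd hdp K hτ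
  | @step dims' i hi I next ih =>
    by_cases hip : i = p
    · subst hip
      have hu (m : ℕ) : ∀ j, j ≠ i → Function.update dims' i m j = dims j :=
        fun j hj => by rw [Function.update_of_ne hj, hd j hj]
      -- Each Kraus operator is absorbed into the accumulated operator; the state `τ`, untouched by
      -- `p`, stays the same in all continuations.
      choose P' hP' using fun (jk : Σ j, Fin (I.krausCount j)) =>
        ih jk.1 (hu (I.outDim jk.1)) hA hB
          (cornerMul (dims' i) (extend (I.kraus jk.1 jk.2)) K) hτ
      -- The best continuation replaces all the others. An instrument without Kraus operators is
      -- possible in dimension zero; any protocol does then.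
      obtain ⟨Q, hQ⟩ : ∃ Q : Protocol S A B a b dims,
          ∀ jk, (P' jk).rawAverage τ ≤ Q.rawAverage τ := by
        by_cases hne : Nonempty (Σ j, Fin (I.krausCount j))
        · obtain ⟨x, hx⟩ := Finite.exists_max fun jk => (P' jk).rawAverage τ
          exact ⟨P' x, hx⟩
        · obtain ⟨Q⟩ := Protocol.nonempty hAB ha hb hA hB
          exact ⟨Q, fun x => (hne ⟨x⟩).elim⟩
      refine ⟨Q, ?_⟩
      rw [rawAverage, ← sum_weight_kraus I K, Finset.sum_mul]
      refine Finset.sum_le_sum fun j _ => ?_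
      rw [Instrument.apply, Finset.sum_mul]
      -- The Kraus operators of one outcome share the continuation `next j`; subadditivity separates
      -- them.
      refine ((next j).rawAverage_sum_le _ fun k =>
        (hτ.mul_mul_conjTranspose_same _).mul_mul_conjTranspose_same _).trans ?_
      refine Finset.sum_le_sum fun k _ => ?_
      have h := hP' ⟨j, k⟩
      rw [Function.update_self, ← opOn_mul_opOn_self hd, ← localOp_eq_opOn] at h
      refine (le_of_eq ?_).trans (h.trans
        (mul_le_mul_of_nonneg_left (hQ ⟨j, k⟩) (weight_nonneg _ _ _)))
      simp only [Matrix.conjTranspose_mul, Matrix.mul_assoc]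
    -- Another party operates: its instrument is performed directly on `τ`, and `K` is carried past
    -- it.
    · have hiS : i ∈ S := hi.resolve_left hip
      have hup (m : ℕ) :
          ∀ j, j ≠ p → Function.update dims' i m j = Function.update dims i m j := by
        intro j hj
        by_cases h : j = i
        · subst h
          simp
        · rw [Function.update_of_ne h, Function.update_of_ne h, hd j hj]
      -- The operating party may lose its prescribed dimension, but it belongs to `S` and can
      -- restore it later.
      have hq (q : Fin n) (c m : ℕ) (h : dims q = c ∨ q ∈ S) :
          Function.update dims i m q = c ∨ q ∈ S := by
        by_cases hqi : q = i
        · exact Or.inr (hqi ▸ hiS)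
        · rwa [Function.update_of_ne hqi]
      choose P' hP' using fun j => ih j (hup (I.outDim j)) (hq _ _ _ hA) (hq _ _ _ hB) K
        ((I.copy (hd i hip)).posSemidef_apply j hτ)
      refine ⟨.step i hiS (I.copy (hd i hip)) P', ?_⟩
      change ∑ j, (next j).rawAverage _ ≤ _ * ∑ j : Fin I.outcomes,
        (P' j).rawAverage ((I.copy (hd i hip)).apply j τ)
      rw [Finset.mul_sum]
      refine Finset.sum_le_sum fun j _ => ?_
      have h := hP' j
      rw [Function.update_of_ne (Ne.symm hip), Function.update_of_ne (Ne.symm hip)] at h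
      rw [I.apply_opOn_conj hip hd]
      exact h

/-- One of the parties `A` and `B` may be excluded from operating without loss. -/
theorem Protocol.exists_rawAverage_ge_of_insert {S : Set (Fin n)} {A B p : Fin n} (hAB : A ≠ B)
    (hp : p = A ∨ p = B) (hpS : p ∉ S) {dims : Fin n → ℕ} (hdims : ∀ i, 0 < dims i)
    (P : Protocol (insert p S) A B (dims A) (dims B) dims) {ρ : Operator dims}
    (hρ : ρ.PosSemidef) :
    ∃ P' : Protocol S A B (dims A) (dims B) dims, P.rawAverage ρ ≤ P'.rawAverage ρ := by
  -- Nothing has been accumulated at the start: `K` is the identity, whose weight is one in positive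
  -- dimension.
  obtain ⟨P', h⟩ := P.exists_rawAverage_le hAB hp hpS (hdims A) (hdims B) (fun _ _ => rfl)
    (Or.inl rfl) (Or.inl rfl) (fun i j => if i = j then 1 else 0) hρ
  rw [opOn_delta, weight_delta (hdims p), Matrix.one_mul, Matrix.conjTranspose_one, Matrix.mul_one,
    one_mul] at h
  exact ⟨P', h⟩

theorem IsState.dims_pos {dims : Fin n → ℕ} {ρ : Operator dims} (hρ : IsState ρ) (i : Fin n) :
    0 < dims i := by
  rw [Nat.pos_iff_ne_zero]
  intro h
  have : IsEmpty (Config dims) := ⟨fun x => (Fin.cast h (x i)).elim0⟩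
  have := hρ.2
  simp [Matrix.trace] at this

/-! ### Comparison of the two suprema -/

theorem collaboration_le_localizable {dims : Fin n → ℕ} {A B : Fin n} (hAB : A ≠ B)
    {ρ : Operator dims} (hρ : IsState ρ) {g : ℝ} (hg : g ∈ collaborationValues A B ρ) :
    ∃ g' ∈ localizableValues A B ρ, g ≤ g' := by
  obtain ⟨P, rfl⟩ := hg
  have hS : (Set.univ : Set (Fin n)) ⊆ insert A (insert B {i | i ≠ A ∧ i ≠ B}) := by
    intro i _
    simp only [Set.mem_insert_iff, Set.mem_ofPred_eq]
    tauto
  obtain ⟨P₁, h₁⟩ := P.exists_rawAverage_eq_of_subset hS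
  obtain ⟨P₂, h₂⟩ := P₁.exists_rawAverage_ge_of_insert hAB (Or.inl rfl) (by simp [hAB])
    hρ.dims_pos hρ.1
  obtain ⟨P₃, h₃⟩ := P₂.exists_rawAverage_ge_of_insert hAB (Or.inr rfl) (by simp)
    hρ.dims_pos hρ.1
  refine ⟨_, ⟨P₃, rfl⟩, ?_⟩
  rw [P.average_eq_rawAverage hρ, P₃.average_eq_rawAverage hρ, ← h₁ ρ]
  exact h₂.trans h₃

theorem localizableValues_subset {dims : Fin n → ℕ} {A B : Fin n} {ρ : Operator dims}
    (hρ : IsState ρ) : localizableValues A B ρ ⊆ collaborationValues A B ρ := by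
  rintro _ ⟨P, rfl⟩
  obtain ⟨P', h⟩ := P.exists_rawAverage_eq_of_subset (Set.subset_univ _)
  exact ⟨P', by rw [P.average_eq_rawAverage hρ, P'.average_eq_rawAverage hρ, h]⟩

theorem bddAbove_collaborationValues {dims : Fin n → ℕ} {A B : Fin n} {ρ : Operator dims}
    (hρ : IsState ρ) : BddAbove (collaborationValues A B ρ) := by
  refine ⟨1, ?_⟩
  rintro _ ⟨P, rfl⟩
  rw [P.average_eq_rawAverage hρ]
  simpa [hρ.2] using P.rawAverage_le_trace hρ.1

end Protocols

end QuantumLOCC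

theorem corollary4 {n : ℕ} (dims : Fin n → ℕ) (A B : Fin n) (hAB : A ≠ B)
    (ρ : QuantumLOCC.Operator dims) (hρ : QuantumLOCC.IsState ρ) :
    BddAbove (QuantumLOCC.localizableValues A B ρ) ∧
    BddAbove (QuantumLOCC.collaborationValues A B ρ) ∧
    QuantumLOCC.localizableEntanglement A B ρ = QuantumLOCC.entanglementOfCollaboration A B ρ := by
  have hsub := QuantumLOCC.localizableValues_subset (A := A) (B := B) hρ
  have hcol := QuantumLOCC.bddAbove_collaborationValues (A := A) (B := B) hρ
  -- The protocol without rounds is always available.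
  have hne : (QuantumLOCC.localizableValues A B ρ).Nonempty := ⟨_, .done rfl rfl, rfl⟩
  refine ⟨hcol.mono hsub, hcol, (csSup_le_csSup hcol hne hsub).antisymm ?_⟩
  refine csSup_le (hne.mono hsub) fun g hg => ?_
  obtain ⟨g', hg', h⟩ := QuantumLOCC.collaboration_le_localizable hAB hρ hg
  exact h.trans (le_csSup (hcol.mono hsub) hg')
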